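/- Let $(a_i)_{i\ge 0}$ be a sequence of positive real numbers with $\sum_{i=0}^\infty a_i<1$ and $\sum_{i=1}^\infty i\,a_i<\infty$. Let $\xi_1,\xi_2,\ldots$ be $\{0,1\}$-valued random variables on a probability space $(\Omega,\mathcal F,\mathbb P)$ such that $\mathbb P(\xi_1=1)=a_0$, $\mathbb P(\xi_1=0)=1-a_0$ and, almost surely for every $n\ge 2$, $$\mathbb P(\xi_n=1\mid \xi_1,\ldots,\xi_{n-1})=a_0+\sum_{i=1}^{n-1}a_{n-i}\xi_i,\qquad \mathbb P(\xi_n=0\mid \xi_1,\ldots,\xi_{n-1})=1-\Big(a_0+\sum_{i=1}^{n-1}a_{n-i}\xi_i\Big).$$ Let $H_n=\sum_{i=1}^n\xi_i$ be the discrete-time Hawkes process. Then for every bounded continuous function $g:[0,1]\to\mathbb R$ the limit $$\Gamma_g=\lim_{n\to\infty}\frac1n\log\mathbb E\big(e^{n g(H_n/n)}\big)\in\mathbb R$$ exists, and $H_n/n$ satisfies the large deviation principle on $[0,1]$ with the good rate function $$R:[0,1]\to[0,\infty],\qquad R(x)=\sup_{g\in C_b([0,1])}\{g(x)-\Gamma_g\}.$$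 That is, for each $\theta\in[0,\infty)$ the level set $\{x\in[0,1]: R(x)\le\theta\}$ is closed and compact; for every closed $F\subseteq[0,1]$, $$\limsup_{n\to\infty}\frac1n\log\mathbb P\Big(\frac{H_n}{n}\in F\Big)\le-\inf_{x\in F}R(x);$$ and for every (relatively) open $G\subseteq[0,1]$, $$\liminf_{n\to\infty}\frac1n\log\mathbb P\Big(\frac{H_n}{n}\in G\Big)\ge-\inf_{x\in G}R(x),$$ with the conventions $\log 0=-\infty$ and $\inf\emptyset=+\infty$. -/

import Mathlib

open MeasureTheory ProbabilityTheory Filter Topology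
open scoped ENNReal NNReal BoundedContinuousFunction

namespace Hawkes

/-- The standing assumptions on the exciting function `(a_i)_{i ≥ 0}`. -/
structure IsExcitingFunction (a : ℕ → ℝ) : Prop where
  pos : ∀ i, 0 < a i
  summable : Summable a
  tsum_lt_one : ∑' i, a i < 1
  summable_mul : Summable fun i : ℕ => (i : ℝ) * a i

/-- The intensity `λ_n = a_0 + ∑_{i=1}^{n-1} a_{n-i} ξ_i`, for `n ≥ 1`. -/
def intensity {Ω : Type*} (a : ℕ → ℝ) (ξ : ℕ → Ω → ℝ) (n : ℕ) (ω : Ω) : ℝ :=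
  a 0 + ∑ i ∈ Finset.Icc 1 (n - 1), a (n - i) * ξ i ω

/-- The σ-algebra `σ(ξ_1, …, ξ_n)`. -/
@[reducible] def history {Ω : Type*} (ξ : ℕ → Ω → ℝ) (n : ℕ) : MeasurableSpace Ω :=
  ⨆ i ∈ Finset.Icc 1 n, MeasurableSpace.comap (ξ i) inferInstance

/-- `ξ_1, ξ_2, …` is an arrival process with exciting function `a`. The arrivals are indexed by
`n ≥ 1`; the value `ξ 0` plays no role. -/
structure IsArrivalProcess {Ω : Type*} [MeasurableSpace Ω] (P : Measure Ω)
    (a : ℕ → ℝ) (ξ : ℕ → Ω → ℝ) : Prop where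
  measurable : ∀ n, 1 ≤ n → Measurable (ξ n)
  zero_or_one : ∀ n, 1 ≤ n → ∀ ω, ξ n ω = 0 ∨ ξ n ω = 1
  prob_first_one : P {ω | ξ 1 ω = 1} = ENNReal.ofReal (a 0)
  prob_first_zero : P {ω | ξ 1 ω = 0} = ENNReal.ofReal (1 - a 0)
  condProb_one : ∀ n, 2 ≤ n →
    P⟦{ω | ξ n ω = 1} | history ξ (n - 1)⟧ =ᵐ[P] fun ω => intensity a ξ n ω
  condProb_zero : ∀ n, 2 ≤ n →
    P⟦{ω | ξ n ω = 0} | history ξ (n - 1)⟧ =ᵐ[P] fun ω => 1 - intensity a ξ n ω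

/-- The discrete-time Hawkes process `H_n = ∑_{i=1}^n ξ_i`. -/
def hawkes {Ω : Type*} (ξ : ℕ → Ω → ℝ) (n : ℕ) (ω : Ω) : ℝ :=
  ∑ i ∈ Finset.Icc 1 n, ξ i ω

theorem IsArrivalProcess.hawkes_div_mem {Ω : Type*} [MeasurableSpace Ω] {P : Measure Ω}
    {a : ℕ → ℝ} {ξ : ℕ → Ω → ℝ} (h : IsArrivalProcess P a ξ) (n : ℕ) (ω : Ω) :
    hawkes ξ n ω / n ∈ Set.Icc (0 : ℝ) 1 := by
  have h0 : ∀ i ∈ Finset.Icc 1 n, 0 ≤ ξ i ω ∧ ξ i ω ≤ 1 := by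
    intro i hi
    rcases h.zero_or_one i (Finset.mem_Icc.1 hi).1 ω with e | e <;> simp [e]
  have h1 : 0 ≤ hawkes ξ n ω := Finset.sum_nonneg fun i hi => (h0 i hi).1
  have h2 : hawkes ξ n ω ≤ n := by
    have := Finset.sum_le_sum fun i hi => (h0 i hi).2
    simpa [hawkes] using this
  exact ⟨by positivity, div_le_one_of_le₀ h2 (Nat.cast_nonneg n)⟩

/-- The random variable `H_n / n`, with values in `[0,1]`. -/
noncomputable def average {Ω : Type*} [MeasurableSpace Ω] {P : Measure Ω}
    {a : ℕ → ℝ} {ξ : ℕ → Ω → ℝ} (h : IsArrivalProcess P a ξ) (n : ℕ) (ω : Ω) :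
    Set.Icc (0 : ℝ) 1 :=
  ⟨hawkes ξ n ω / n, h.hawkes_div_mem n ω⟩

/-- A rate function on `X`: every level set is closed. -/
def IsRateFunction {X : Type*} [TopologicalSpace X] (I : X → ℝ≥0∞) : Prop :=
  ∀ θ : ℝ≥0, IsClosed {x | I x ≤ θ}

/-- A good rate function: a rate function all of whose level sets are compact. -/
def IsGoodRateFunction {X : Type*} [TopologicalSpace X] (I : X → ℝ≥0∞) : Prop :=
  IsRateFunction I ∧ ∀ θ : ℝ≥0, IsCompact {x | I x ≤ θ}

/-- `(1/n) log P(Y ∈ A)`, an extended real number (with `log 0 = -∞`). -/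
noncomputable def scaledLogProb {Ω X : Type*} [MeasurableSpace Ω] (P : Measure Ω)
    (Y : Ω → X) (n : ℕ) (A : Set X) : EReal :=
  ((1 / (n : ℝ) : ℝ) : EReal) * ENNReal.log (P (Y ⁻¹' A))

/-- The `X`-valued random variables `Y_n` (here `Y_n = S_n / n`) satisfy the large deviation
principle with speed `n` and rate function `I`. -/
structure SatisfiesLDP {Ω X : Type*} [MeasurableSpace Ω] [TopologicalSpace X] (P : Measure Ω)
    (Y : ℕ → Ω → X) (I : X → ℝ≥0∞) : Prop where
  isRateFunction : IsRateFunction I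
  upper : ∀ F : Set X, IsClosed F →
    limsup (fun n : ℕ => scaledLogProb P (Y n) n F) atTop ≤ -(⨅ x ∈ F, (I x : EReal))
  lower : ∀ G : Set X, IsOpen G →
    -(⨅ x ∈ G, (I x : EReal)) ≤ liminf (fun n : ℕ => scaledLogProb P (Y n) n G) atTop

end Hawkes

/-!
Since the intensity stays between `a 0 > 0` and `∑ a < 1`, every letter has conditional probability
at least some `c > 0`. A past that ended `k` steps ago shifts the intensity by at most the tail sum
`∑_{i ≥ k} a_i`, and these tail sums add up to `∑ i a_i < ∞`. Hence the probability of a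
concatenation of two words is at least a constant times the product of their probabilities, with a
constant independent of the words (`IsExcitingFunction.splitConst_mul_le`).

The set of words whose density of ones is within `ε` of `x` is closed under concatenation. Filling
the time interval with blocks of a fixed length therefore bounds the probability of a density near
`x` at all large times from below by its exponential rate at any single time. So the upper and
lower rates of decay agree at `x`, and their common value `localRate` is finite
(`IsExcitingFunction.exp_le_nearProb`, `IsExcitingFunction.nearProb_le_exp`).

On a compact space such local estimates give everything else by finite covers: the rate is lower
semicontinuous, Varadhan's limits `Γ_g = sup (g - J)` exist (`HasLocalRate.tendsto_gamma`), the large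
deviation principle holds with rate `J` (`HasLocalRate.satisfiesLDP`), and `J` is the conjugate of
`g ↦ Γ_g` (`HasLocalRate.coe_ofReal_eq_iSup`).
-/

namespace Hawkes

/-! ### From local exponential estimates to the large deviation principle -/

/-- The probability that `Y n` lies in a small ball about `x` is `exp (-n (J x + o(1)))`: from below
for every radius, from above for some radius depending on the precision. The bounds hold for large
`n` and the rate `J` is real-valued. -/
structure HasLocalRate {Ω X : Type*} [MeasurableSpace Ω] [MetricSpace X] (P : Measure Ω)
    (Y : ℕ → Ω → X) (J : X → ℝ) : Prop where
  nonneg : ∀ x, 0 ≤ J x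
  lower : ∀ x, ∀ ε > 0, ∀ δ > 0, ∀ᶠ n : ℕ in atTop,
    Real.exp (-(n * (J x + δ))) ≤ P.real (Y n ⁻¹' Metric.closedBall x ε)
  upper : ∀ x, ∀ δ > 0, ∃ ε > 0, ∀ᶠ n : ℕ in atTop,
    P.real (Y n ⁻¹' Metric.closedBall x ε) ≤ Real.exp (-(n * (J x - δ)))

/-- A constant factor is absorbed by an arbitrarily small exponential gain. -/
theorem eventually_mul_exp_le (C : ℝ) {s t : ℝ} (h : s < t) :
    ∀ᶠ n : ℕ in atTop, C * Real.exp (n * s) ≤ Real.exp (n * t) := by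
  have h1 : Tendsto (fun n : ℕ => Real.exp (n * (t - s))) atTop atTop :=
    Real.tendsto_exp_atTop.comp
      (tendsto_natCast_atTop_atTop.atTop_mul_const (sub_pos.2 h))
  filter_upwards [h1.eventually_ge_atTop C] with n hn
  calc C * Real.exp (n * s) ≤ Real.exp (n * (t - s)) * Real.exp (n * s) := by gcongr
    _ = Real.exp (n * t) := by rw [← Real.exp_add]; ring_nf

theorem le_scaledLogProb {Ω X : Type*} [MeasurableSpace Ω] {P : Measure Ω} [IsFiniteMeasure P]
    {Y : Ω → X} {A : Set X} {n : ℕ} (hn : 0 < n) {c : ℝ}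
    (h : Real.exp (n * c) ≤ P.real (Y ⁻¹' A)) : (c : EReal) ≤ scaledLogProb P Y n A := by
  have hn' : (0 : ℝ) < n := Nat.cast_pos.2 hn
  have h1 : ((n * c : ℝ) : EReal) ≤ ENNReal.log (P (Y ⁻¹' A)) := by
    have : ENNReal.ofReal (Real.exp (n * c)) ≤ P (Y ⁻¹' A) :=
      ENNReal.ofReal_le_of_le_toReal h
    have h2 := ENNReal.log_le_log_iff.2 this
    rwa [ENNReal.log_ofReal, if_neg (not_le.2 (Real.exp_pos _)), Real.log_exp] at h2
  have h0 : (0 : EReal) ≤ ((1 / (n : ℝ) : ℝ) : EReal) := by exact_mod_cast (by positivity)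
  refine le_trans (le_of_eq ?_) (mul_le_mul_of_nonneg_left h1 h0)
  rw [← EReal.coe_mul]
  congr 1
  field_simp

theorem scaledLogProb_le {Ω X : Type*} [MeasurableSpace Ω] {P : Measure Ω} [IsFiniteMeasure P]
    {Y : Ω → X} {A : Set X} {n : ℕ} (hn : 0 < n) {c : ℝ}
    (h : P.real (Y ⁻¹' A) ≤ Real.exp (n * c)) : scaledLogProb P Y n A ≤ c := by
  have hn' : (0 : ℝ) < n := Nat.cast_pos.2 hn
  have h1 : ENNReal.log (P (Y ⁻¹' A)) ≤ ((n * c : ℝ) : EReal) := by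
    have : P (Y ⁻¹' A) ≤ ENNReal.ofReal (Real.exp (n * c)) :=
      (ENNReal.le_ofReal_iff_toReal_le (measure_ne_top _ _) (Real.exp_pos _).le).2 h
    have h2 := ENNReal.log_le_log_iff.2 this
    rwa [ENNReal.log_ofReal, if_neg (not_le.2 (Real.exp_pos _)), Real.log_exp] at h2
  have h0 : (0 : EReal) ≤ ((1 / (n : ℝ) : ℝ) : EReal) := by exact_mod_cast (by positivity)
  refine (mul_le_mul_of_nonneg_left h1 h0).trans (le_of_eq ?_)
  rw [← EReal.coe_mul]
  congr 1
  field_simp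

namespace HasLocalRate

variable {Ω X : Type*} [MeasurableSpace Ω] [MetricSpace X] {P : Measure Ω}
  {Y : ℕ → Ω → X} {J : X → ℝ}

/-- Varadhan's limit: the supremum of `g - J`. -/
noncomputable def gamma (J : X → ℝ) (g : X →ᵇ ℝ) : ℝ := ⨆ x, (g x - J x)

theorem bddAbove (h : HasLocalRate P Y J) (g : X →ᵇ ℝ) :
    BddAbove (Set.range fun x => g x - J x) := by
  refine ⟨‖g‖, ?_⟩
  rintro _ ⟨x, rfl⟩
  have h1 := (le_abs_self _).trans (g.norm_coe_le_norm x)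
  have h2 := h.nonneg x
  simp only
  linarith

theorem sub_le_gamma (h : HasLocalRate P Y J) (g : X →ᵇ ℝ) (x : X) :
    g x - J x ≤ gamma J g := le_ciSup (h.bddAbove g) x

variable [IsProbabilityMeasure P]

theorem eventually_lt (h : HasLocalRate P Y J) {x : X} {t : ℝ} (ht : t < J x) :
    ∃ ε > 0, ∀ y, dist y x < ε → t < J y := by
  obtain ⟨ε, hε, hU⟩ := h.upper x ((J x - t) / 3) (by linarith)
  refine ⟨ε, hε, fun y hy => ?_⟩
  by_contra! hJ
  have hL := h.lower y (ε - dist y x) (by linarith) ((J x - t) / 3) (by linarith)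
  obtain ⟨n, h1, h2, hn⟩ := (hU.and (hL.and (eventually_gt_atTop 0))).exists
  have hsub : Y n ⁻¹' Metric.closedBall y (ε - dist y x) ⊆ Y n ⁻¹' Metric.closedBall x ε :=
    Set.preimage_mono (Metric.closedBall_subset_closedBall' (by linarith))
  have h3 := (h2.trans (measureReal_mono hsub)).trans h1
  rw [Real.exp_le_exp, neg_le_neg_iff] at h3
  have hn' : (0 : ℝ) < n := Nat.cast_pos.2 hn
  have h4 := le_of_mul_le_mul_left h3 hn'
  linarith

theorem lowerSemicontinuous (h : HasLocalRate P Y J) : LowerSemicontinuous J := by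
  intro x t ht
  obtain ⟨ε, hε, H⟩ := h.eventually_lt ht
  exact Metric.eventually_nhds_iff.2 ⟨ε, hε, fun {y} hy => H y hy⟩

theorem isGoodRateFunction [CompactSpace X] (h : HasLocalRate P Y J) :
    IsGoodRateFunction fun x => ENNReal.ofReal (J x) := by
  have hcl : IsRateFunction fun x => ENNReal.ofReal (J x) := by
    intro θ
    have : {x | ENNReal.ofReal (J x) ≤ θ} = J ⁻¹' Set.Iic (θ : ℝ) := by
      ext x
      simp [ENNReal.ofReal_le_coe]
    rw [this]
    exact h.lowerSemicontinuous.isClosed_preimage _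
  exact ⟨hcl, fun θ => (hcl θ).isCompact⟩

/-- Upper bound over a compact set, for a tilted integrand. Taking `g = 0` gives the bound on
probabilities, taking `K` the whole space gives Varadhan's upper bound. -/
theorem setIntegral_exp_le [MeasurableSpace X] [BorelSpace X] (hY : ∀ n, Measurable (Y n))
    (h : HasLocalRate P Y J) {K : Set X} (hK : IsCompact K) (g : X →ᵇ ℝ) {c : ℝ}
    (hc : ∀ x ∈ K, g x - J x ≤ c) {c' : ℝ} (hcc : c < c') :
    ∀ᶠ n : ℕ in atTop, ∫ ω in Y n ⁻¹' K, Real.exp (n * g (Y n ω)) ∂P ≤ Real.exp (n * c') := by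
  set δ := (c' - c) / 3 with hδ
  have hδ0 : 0 < δ := by rw [hδ]; linarith
  have loc : ∀ x, ∃ ε > 0, (∀ y ∈ Metric.closedBall x ε, g y ≤ g x + δ) ∧
      ∀ᶠ n : ℕ in atTop, P.real (Y n ⁻¹' Metric.closedBall x ε) ≤
        Real.exp (-(n * (J x - δ))) := by
    intro x
    obtain ⟨ε, hε, hU⟩ := h.upper x δ hδ0
    obtain ⟨η, hη, hg⟩ := Metric.continuous_iff.1 g.continuous x δ hδ0
    refine ⟨min ε (η / 2), by positivity, fun y hy => ?_, ?_⟩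
    · have hy' : dist y x < η := by
        have := (Metric.mem_closedBall.1 hy).trans (min_le_right _ _)
        linarith
      have := (abs_lt.1 (by simpa [Real.dist_eq] using hg y hy')).2
      linarith
    · filter_upwards [hU] with n hn
      exact (measureReal_mono (Set.preimage_mono
        (Metric.closedBall_subset_closedBall (min_le_left _ _)))).trans hn
  choose ε hε hg hU using loc
  obtain ⟨t, htK, ht⟩ := hK.elim_nhds_subcover (fun x => Metric.closedBall x (ε x))
    fun x _ => Metric.closedBall_mem_nhds x (hε x)
  have hall : ∀ᶠ n : ℕ in atTop, ∀ x ∈ t, P.real (Y n ⁻¹' Metric.closedBall x (ε x)) ≤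
      Real.exp (-(n * (J x - δ))) := (t.eventually_all).2 fun x _ => hU x
  filter_upwards [hall, eventually_mul_exp_le t.card (show c + 2 * δ < c' by rw [hδ]; linarith)]
    with n hn hn'
  refine le_trans ?_ hn'
  have hm : ∀ x, MeasurableSet (Y n ⁻¹' Metric.closedBall x (ε x)) := fun x =>
    hY n Metric.isClosed_closedBall.measurableSet
  have hint : ∀ x, Integrable
      ((Y n ⁻¹' Metric.closedBall x (ε x)).indicator fun _ => Real.exp (n * (g x + δ))) P :=
    fun x => (integrable_const _).indicator (hm x)
  calc ∫ ω in Y n ⁻¹' K, Real.exp (n * g (Y n ω)) ∂P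
      ≤ ∫ ω in Y n ⁻¹' K, ∑ x ∈ t, (Y n ⁻¹' Metric.closedBall x (ε x)).indicator
          (fun _ => Real.exp (n * (g x + δ))) ω ∂P := by
        refine integral_mono_of_nonneg (ae_of_all _ fun _ => (Real.exp_pos _).le)
          (integrable_finsetSum _ fun x _ => (hint x).integrableOn) ?_
        filter_upwards [ae_restrict_mem (hY n hK.isClosed.measurableSet)] with ω hω
        obtain ⟨x, hx, hωx⟩ := Set.mem_iUnion₂.1 (ht hω)
        have hnn : ∀ z ∈ t, 0 ≤ (Y n ⁻¹' Metric.closedBall z (ε z)).indicator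
            (fun _ => Real.exp (n * (g z + δ))) ω := fun z _ =>
          Set.indicator_nonneg (fun _ _ => (Real.exp_pos _).le) _
        refine le_trans ?_ (Finset.single_le_sum hnn hx)
        rw [Set.indicator_of_mem (by exact hωx)]
        have := hg x _ hωx
        gcongr
    _ ≤ ∫ ω, ∑ x ∈ t, (Y n ⁻¹' Metric.closedBall x (ε x)).indicator
          (fun _ => Real.exp (n * (g x + δ))) ω ∂P := by
        refine setIntegral_le_integral (integrable_finsetSum _ fun x _ => hint x) ?_
        exact ae_of_all _ fun ω => Finset.sum_nonneg fun z _ =>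
          Set.indicator_nonneg (fun _ _ => (Real.exp_pos _).le) _
    _ = ∑ x ∈ t, P.real (Y n ⁻¹' Metric.closedBall x (ε x)) * Real.exp (n * (g x + δ)) := by
        rw [integral_finsetSum _ fun x _ => hint x]
        refine Finset.sum_congr rfl fun x _ => ?_
        rw [integral_indicator_const _ (hm x), smul_eq_mul]
    _ ≤ ∑ x ∈ t, Real.exp (n * (c + 2 * δ)) := by
        refine Finset.sum_le_sum fun x hx => ?_
        calc _ ≤ Real.exp (-(n * (J x - δ))) * Real.exp (n * (g x + δ)) := by
              gcongr; exact hn x hx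
          _ = Real.exp (n * (g x - J x + 2 * δ)) := by rw [← Real.exp_add]; ring_nf
          _ ≤ _ := by gcongr; exact hc x (htK x hx)
    _ = t.card * Real.exp (n * (c + 2 * δ)) := by simp

theorem integrable_exp [MeasurableSpace X] [BorelSpace X] (hY : ∀ n, Measurable (Y n))
    (g : X →ᵇ ℝ) (n : ℕ) : Integrable (fun ω => Real.exp (n * g (Y n ω))) P := by
  refine Integrable.of_bound (C := Real.exp (n * ‖g‖)) ?_ (ae_of_all _ fun ω => ?_)
  · have := g.continuous.measurable.comp (hY n)
    exact (Real.measurable_exp.comp (this.const_mul (n : ℝ))).aestronglyMeasurable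
  · rw [Real.norm_eq_abs, abs_of_pos (Real.exp_pos _)]
    have := (le_abs_self _).trans (g.norm_coe_le_norm (Y n ω))
    gcongr

theorem le_integral_exp [MeasurableSpace X] [BorelSpace X] (hY : ∀ n, Measurable (Y n))
    (h : HasLocalRate P Y J) (g : X →ᵇ ℝ) (x : X) {c : ℝ} (hc : c < g x - J x) :
    ∀ᶠ n : ℕ in atTop, Real.exp (n * c) ≤ ∫ ω, Real.exp (n * g (Y n ω)) ∂P := by
  set δ := (g x - J x - c) / 2 with hδ
  have hδ0 : 0 < δ := by rw [hδ]; linarith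
  obtain ⟨η, hη, hg⟩ := Metric.continuous_iff.1 g.continuous x δ hδ0
  filter_upwards [h.lower x (η / 2) (by linarith) δ hδ0] with n hn
  have hm : MeasurableSet (Y n ⁻¹' Metric.closedBall x (η / 2)) :=
    hY n Metric.isClosed_closedBall.measurableSet
  calc Real.exp (n * c) = Real.exp (-(n * (J x + δ))) * Real.exp (n * (g x - δ)) := by
        rw [← Real.exp_add]
        congr 1
        rw [hδ]
        ring
    _ ≤ P.real (Y n ⁻¹' Metric.closedBall x (η / 2)) * Real.exp (n * (g x - δ)) := by gcongr
    _ = ∫ ω, (Y n ⁻¹' Metric.closedBall x (η / 2)).indicator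
          (fun _ => Real.exp (n * (g x - δ))) ω ∂P := by
        rw [integral_indicator_const _ hm, smul_eq_mul]
    _ ≤ ∫ ω, Real.exp (n * g (Y n ω)) ∂P := by
        refine integral_mono ((integrable_const _).indicator hm) (integrable_exp hY g n) ?_
        intro ω
        by_cases hω : ω ∈ Y n ⁻¹' Metric.closedBall x (η / 2)
        swap
        · rw [Set.indicator_of_notMem hω]
          exact (Real.exp_pos _).le
        rw [Set.indicator_of_mem hω]
        have hω' : dist (Y n ω) x < η := by
          have := Metric.mem_closedBall.1 hω
          linarith
        have := (abs_lt.1 (by simpa [Real.dist_eq] using hg _ hω')).1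
        simp only
        gcongr
        linarith

/-- Varadhan's lemma. -/
theorem tendsto_gamma [CompactSpace X] [Nonempty X] [MeasurableSpace X] [BorelSpace X]
    (hY : ∀ n, Measurable (Y n)) (h : HasLocalRate P Y J) (g : X →ᵇ ℝ) :
    Tendsto (fun n : ℕ => (1 / (n : ℝ)) * Real.log (∫ ω, Real.exp (n * g (Y n ω)) ∂P))
      atTop (𝓝 (gamma J g)) := by
  have hpos : ∀ n, 0 < ∫ ω, Real.exp (n * g (Y n ω)) ∂P := fun n =>
    integral_exp_pos (integrable_exp hY g n)
  refine tendsto_order.2 ⟨fun b hb => ?_, fun b hb => ?_⟩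
  · obtain ⟨x, hx⟩ := exists_lt_of_lt_ciSup hb
    obtain ⟨c, hbc, hc⟩ := exists_between hx
    filter_upwards [h.le_integral_exp hY g x hc, eventually_gt_atTop 0] with n hn hn0
    have hn' : (0 : ℝ) < n := Nat.cast_pos.2 hn0
    have := (Real.le_log_iff_exp_le (hpos n)).2 hn
    rw [one_div, inv_mul_eq_div, lt_div_iff₀ hn']
    nlinarith
  · obtain ⟨c, hc, hcb⟩ := exists_between hb
    filter_upwards [h.setIntegral_exp_le hY isCompact_univ g
      (fun x _ => h.sub_le_gamma g x) hc, eventually_gt_atTop 0] with n hn hn0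
    have hn' : (0 : ℝ) < n := Nat.cast_pos.2 hn0
    rw [Set.preimage_univ, Measure.restrict_univ] at hn
    have := (Real.log_le_iff_le_exp (hpos n)).2 hn
    rw [one_div, inv_mul_eq_div, div_lt_iff₀ hn']
    nlinarith

/-- The rate is recovered from Varadhan's limits: it is lower semicontinuous, so a function peaked
at `x` detects `J x`. -/
theorem coe_ofReal_eq_iSup [CompactSpace X] [Nonempty X] (h : HasLocalRate P Y J) (x : X) :
    ((ENNReal.ofReal (J x) : ℝ≥0∞) : EReal) = ⨆ g : X →ᵇ ℝ, ((g x - gamma J g : ℝ) : EReal) := by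
  rw [EReal.coe_ennreal_ofReal, max_eq_left (h.nonneg x)]
  apply le_antisymm
  · refine le_of_forall_lt fun c hc => ?_
    obtain ⟨t, hct, htJ⟩ := EReal.lt_iff_exists_real_btwn.1 hc
    have htJ' : t < J x := EReal.coe_lt_coe_iff.1 htJ
    obtain ⟨ε, hε, hJ⟩ := h.eventually_lt htJ'
    -- `g` vanishes at `x` and is at most `-|t|` at distance `ε` from `x`.
    set g : X →ᵇ ℝ := BoundedContinuousFunction.mkOfCompact
      ⟨fun y => -(|t| / ε * dist y x), by fun_prop⟩ with hg
    have hgy : ∀ y, g y = -(|t| / ε * dist y x) := fun y => rfl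
    have hgam : gamma J g ≤ -t := by
      refine ciSup_le fun y => ?_
      rw [hgy]
      have h0 : 0 ≤ |t| / ε * dist y x := by positivity
      rcases lt_or_ge (dist y x) ε with hy | hy
      · have := hJ y hy
        linarith
      · have h1 : |t| / ε * ε ≤ |t| / ε * dist y x := by gcongr
        rw [div_mul_cancel₀ _ hε.ne'] at h1
        have h2 := h.nonneg y
        have h3 := le_abs_self t
        linarith
    refine hct.trans_le (le_trans ?_ (le_iSup _ g))
    rw [EReal.coe_le_coe_iff, hgy, dist_self]
    linarith
  · refine iSup_le fun g => ?_
    rw [EReal.coe_le_coe_iff]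
    have := h.sub_le_gamma g x
    linarith

theorem satisfiesLDP [CompactSpace X] [MeasurableSpace X] [BorelSpace X]
    (hY : ∀ n, Measurable (Y n)) (h : HasLocalRate P Y J) :
    SatisfiesLDP P Y fun x => ENNReal.ofReal (J x) := by
  have hJ : ∀ x, ((ENNReal.ofReal (J x) : ℝ≥0∞) : EReal) = (J x : ℝ) := fun x => by
    rw [EReal.coe_ennreal_ofReal, max_eq_left (h.nonneg x)]
  refine ⟨h.isGoodRateFunction.1, fun F hF => ?_, fun G hG => ?_⟩
  · simp only [hJ]
    rw [EReal.le_neg]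
    refine le_of_forall_lt fun c hc => ?_
    obtain ⟨s, hcs, hs⟩ := EReal.lt_iff_exists_real_btwn.1 hc
    obtain ⟨s', hss, hs'⟩ := EReal.lt_iff_exists_real_btwn.1 hs
    refine hcs.trans_le (EReal.le_neg.2 (limsup_le_of_le (by isBoundedDefault) ?_))
    have hF' : ∀ x ∈ F, (0 : X →ᵇ ℝ) x - J x ≤ -s' := fun x hx => by
      have : (s' : EReal) ≤ J x := hs'.le.trans (iInf₂_le x hx)
      have := EReal.coe_le_coe_iff.1 this
      simpa using this
    filter_upwards [h.setIntegral_exp_le hY hF.isCompact 0 hF'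
      (neg_lt_neg (EReal.coe_lt_coe_iff.1 hss)), eventually_gt_atTop 0] with n hn hn0
    rw [← EReal.coe_neg]
    exact scaledLogProb_le hn0 (by simpa using hn)
  · simp only [hJ]
    rw [EReal.neg_le]
    refine le_iInf₂ fun x hx => ?_
    rw [EReal.neg_le]
    refine le_of_forall_lt fun c hc => ?_
    obtain ⟨s, hcs, hs⟩ := EReal.lt_iff_exists_real_btwn.1 hc
    rw [← EReal.coe_neg, EReal.coe_lt_coe_iff] at hs
    refine hcs.trans_le (le_liminf_of_le (by isBoundedDefault) ?_)
    obtain ⟨ε, hε, hεG⟩ := Metric.nhds_basis_closedBall.mem_iff.1 (hG.mem_nhds hx)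
    filter_upwards [h.lower x ε hε (-J x - s) (by linarith), eventually_gt_atTop 0] with n hn hn0
    refine le_scaledLogProb hn0 ?_
    refine le_trans (le_of_eq ?_) (hn.trans (measureReal_mono (Set.preimage_mono hεG)))
    congr 1
    ring

end HasLocalRate

end Hawkes

namespace Hawkes

/-! ### Word probabilities and their almost multiplicativity -/

/-- The contribution of the past `w` to the intensity, when the most recent letter of `w` carries
weight `a j`. Words list the letters from the most recent to the oldest. -/
def excite (a : ℕ → ℝ) : ℕ → List Bool → ℝ
  | _, [] => 0
  | j, b :: w => (if b then a j else 0) + excite a (j + 1) w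

/-- The conditional probability of the letter `b` given the past `w`. -/
def letterProb (a : ℕ → ℝ) (b : Bool) (w : List Bool) : ℝ :=
  if b then a 0 + excite a 1 w else 1 - (a 0 + excite a 1 w)

/-- The probability of the word `w`, whose head is the most recent letter. -/
def wordProb (a : ℕ → ℝ) : List Bool → ℝ
  | [] => 1
  | b :: w => letterProb a b w * wordProb a w

/-- The tail sum `∑_{i ≥ j} a_i`. -/
noncomputable def tail (a : ℕ → ℝ) (j : ℕ) : ℝ := ∑' i, a (i + j)

section Excite

variable {a : ℕ → ℝ}

theorem IsExcitingFunction.summable_shift (ha : IsExcitingFunction a) (j : ℕ) :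
    Summable fun i => a (i + j) := (summable_nat_add_iff j).2 ha.summable

theorem IsExcitingFunction.tail_eq (ha : IsExcitingFunction a) (j : ℕ) :
    tail a j = a j + tail a (j + 1) := by
  rw [tail, (ha.summable_shift j).tsum_eq_zero_add, zero_add]
  congr 1
  exact tsum_congr fun i => by congr 1; ring

theorem IsExcitingFunction.tail_nonneg (ha : IsExcitingFunction a) (j : ℕ) : 0 ≤ tail a j :=
  tsum_nonneg fun _ => (ha.pos _).le

theorem IsExcitingFunction.excite_nonneg (ha : IsExcitingFunction a) (j : ℕ) (w : List Bool) :
    0 ≤ excite a j w := by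
  induction w generalizing j with
  | nil => simp [excite]
  | cons b w ih =>
    have h1 := ih (j + 1)
    have h2 := (ha.pos j).le
    rw [excite]
    split_ifs <;> linarith

theorem IsExcitingFunction.excite_le_tail (ha : IsExcitingFunction a) (j : ℕ) (w : List Bool) :
    excite a j w ≤ tail a j := by
  induction w generalizing j with
  | nil => simpa [excite] using ha.tail_nonneg j
  | cons b w ih =>
    have h1 := ih (j + 1)
    have h2 := (ha.pos j).le
    rw [excite, ha.tail_eq j]
    split_ifs <;> linarith

theorem excite_append (a : ℕ → ℝ) (j : ℕ) (y x : List Bool) :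
    excite a j (y ++ x) = excite a j y + excite a (j + y.length) x := by
  induction y generalizing j with
  | nil => simp [excite]
  | cons b y ih =>
    rw [List.cons_append, excite, excite, ih, List.length_cons]
    rw [show j + 1 + y.length = j + (y.length + 1) by ring]
    ring

/-- Here the first-moment assumption on `a` enters: the tail sums are summable. -/
theorem IsExcitingFunction.sum_tail_le (ha : IsExcitingFunction a) (n : ℕ) :
    ∑ k ∈ Finset.range n, tail a (k + 1) ≤ ∑' i : ℕ, (i : ℝ) * a i := by
  have h1 : ∀ k, tail a (k + 1) = ∑' i, if k < i then a i else 0 := by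
    intro k
    have hs : Summable fun i => if k < i then a i else 0 :=
      ha.summable.of_nonneg_of_le (fun i => by split_ifs <;> simp [(ha.pos i).le])
        (fun i => by split_ifs <;> simp [(ha.pos i).le])
    rw [← hs.sum_add_tsum_nat_add (k + 1), Finset.sum_eq_zero, zero_add, tail]
    · exact tsum_congr fun i => by rw [if_pos (by omega)]
    · intro i hi
      rw [if_neg (by have := Finset.mem_range.1 hi; omega)]
  have hs : ∀ k ∈ Finset.range n, Summable fun i => if k < i then a i else 0 := fun k _ =>
    ha.summable.of_nonneg_of_le (fun i => by split_ifs <;> simp [(ha.pos i).le])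
      (fun i => by split_ifs <;> simp [(ha.pos i).le])
  simp_rw [h1]
  rw [← Summable.tsum_finsetSum hs]
  refine (summable_sum hs).tsum_le_tsum (fun i => ?_) ha.summable_mul
  rw [← Finset.sum_filter, Finset.sum_const, nsmul_eq_mul]
  gcongr
  · exact (ha.pos i).le
  · calc _ ≤ (Finset.range i).card := Finset.card_le_card fun k hk => by
            simpa using (Finset.mem_filter.1 hk).2
      _ = i := Finset.card_range i

/-- A common lower bound for the conditional probabilities of both letters. -/
noncomputable def minProb (a : ℕ → ℝ) : ℝ := min (a 0) (1 - tail a 0)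

theorem IsExcitingFunction.tail_zero_lt_one (ha : IsExcitingFunction a) : tail a 0 < 1 := by
  simpa [tail] using ha.tsum_lt_one

theorem IsExcitingFunction.minProb_pos (ha : IsExcitingFunction a) : 0 < minProb a :=
  lt_min (ha.pos 0) (by linarith [ha.tail_zero_lt_one])

theorem IsExcitingFunction.minProb_le_letterProb (ha : IsExcitingFunction a) (b : Bool)
    (w : List Bool) : minProb a ≤ letterProb a b w := by
  have h0 := ha.excite_nonneg 1 w
  have h1 := ha.excite_le_tail 1 w
  have h2 := ha.tail_eq 0
  rw [zero_add] at h2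
  rw [letterProb]
  split_ifs
  · exact (min_le_left _ _).trans (by linarith)
  · exact (min_le_right _ _).trans (by linarith)

theorem IsExcitingFunction.minProb_pow_le_wordProb (ha : IsExcitingFunction a) (w : List Bool) :
    minProb a ^ w.length ≤ wordProb a w := by
  induction w with
  | nil => simp [wordProb]
  | cons b w ih =>
    rw [wordProb, List.length_cons, pow_succ']
    exact mul_le_mul (ha.minProb_le_letterProb b w) ih (pow_nonneg ha.minProb_pos.le _)
      (ha.minProb_pos.le.trans (ha.minProb_le_letterProb b w))

theorem IsExcitingFunction.wordProb_nonneg (ha : IsExcitingFunction a) (w : List Bool) :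
    0 ≤ wordProb a w :=
  (pow_nonneg ha.minProb_pos.le _).trans (ha.minProb_pow_le_wordProb w)

/-- Placing a remote past `x` before the past `y` lowers no conditional probability by more than a
factor controlled by the tail sum from the distance of `x`. -/
theorem IsExcitingFunction.letterProb_append (ha : IsExcitingFunction a) (b : Bool)
    (y x : List Bool) :
    Real.exp (-(tail a (y.length + 1) / minProb a)) * letterProb a b y ≤
      letterProb a b (y ++ x) := by
  have hc := ha.minProb_pos
  have hT := ha.tail_nonneg (y.length + 1)
  have e0 := ha.excite_nonneg (1 + y.length) x
  have e1 := ha.excite_le_tail (1 + y.length) x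
  rw [add_comm 1] at e0 e1
  have hl := ha.minProb_le_letterProb b y
  have hl' := ha.minProb_le_letterProb b (y ++ x)
  have key : letterProb a b y ≤ letterProb a b (y ++ x) + tail a (y.length + 1) := by
    simp only [letterProb, excite_append, add_comm 1 y.length]
    split_ifs <;> linarith
  rw [Real.exp_neg, inv_mul_le_iff₀ (Real.exp_pos _)]
  calc letterProb a b y ≤ letterProb a b (y ++ x) + tail a (y.length + 1) := key
    _ = letterProb a b (y ++ x) + tail a (y.length + 1) / minProb a * minProb a := by
        rw [div_mul_cancel₀ _ hc.ne']
    _ ≤ letterProb a b (y ++ x) + tail a (y.length + 1) / minProb a * letterProb a b (y ++ x) := by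
        gcongr
    _ = (tail a (y.length + 1) / minProb a + 1) * letterProb a b (y ++ x) := by ring
    _ ≤ _ := by
        gcongr
        · exact hc.le.trans hl'
        · exact Real.add_one_le_exp _

/-- The constant in the almost multiplicativity of word probabilities. -/
noncomputable def splitConst (a : ℕ → ℝ) : ℝ := Real.exp (-((∑' i : ℕ, (i : ℝ) * a i) / minProb a))

theorem splitConst_pos (a : ℕ → ℝ) : 0 < splitConst a := Real.exp_pos _

/-- Super-multiplicativity of word probabilities, up to a constant which does not depend on the
lengths of the words. -/
theorem IsExcitingFunction.splitConst_mul_le (ha : IsExcitingFunction a) (y x : List Bool) :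
    splitConst a * (wordProb a y * wordProb a x) ≤ wordProb a (y ++ x) := by
  have main : Real.exp (-((∑ k ∈ Finset.range y.length, tail a (k + 1)) / minProb a)) *
      (wordProb a y * wordProb a x) ≤ wordProb a (y ++ x) := by
    induction y with
    | nil => simp [wordProb]
    | cons b y ih =>
      rw [List.cons_append, wordProb, wordProb, List.length_cons, Finset.sum_range_succ, add_div,
        neg_add, Real.exp_add]
      refine le_trans (le_of_eq ?_) (mul_le_mul (ha.letterProb_append b y x) ih ?_ ?_)
      · ring
      · exact mul_nonneg (Real.exp_pos _).le
          (mul_nonneg (ha.wordProb_nonneg _) (ha.wordProb_nonneg _))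
      · exact ha.minProb_pos.le.trans (ha.minProb_le_letterProb _ _)
  refine le_trans ?_ main
  have h1 := ha.sum_tail_le y.length
  have h2 := ha.minProb_pos
  have h3 := mul_nonneg (ha.wordProb_nonneg y) (ha.wordProb_nonneg x)
  rw [splitConst]
  gcongr

end Excite

/-! ### Word counts near a given density -/

/-- The words of length `n`. -/
noncomputable def words (n : ℕ) : Finset (List Bool) := (List.finite_length_eq Bool n).toFinset

@[simp]
theorem mem_words {n : ℕ} {w : List Bool} : w ∈ words n ↔ w.length = n := by simp [words]

/-- The words of length `n` whose number of ones is within `s` of `n * x`. -/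
noncomputable def nearWords (n : ℕ) (x s : ℝ) : Finset (List Bool) :=
  {w ∈ words n | |(w.count true : ℝ) - n * x| ≤ s}

/-- The total probability of `nearWords n x s`. -/
noncomputable def nearProb (a : ℕ → ℝ) (n : ℕ) (x s : ℝ) : ℝ :=
  ∑ w ∈ nearWords n x s, wordProb a w

theorem mem_nearWords {n : ℕ} {x s : ℝ} {w : List Bool} :
    w ∈ nearWords n x s ↔ w.length = n ∧ |(w.count true : ℝ) - n * x| ≤ s := by
  simp [nearWords]

section Near

variable {a : ℕ → ℝ}

theorem IsExcitingFunction.nearProb_nonneg (ha : IsExcitingFunction a) (n : ℕ) (x s : ℝ) :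
    0 ≤ nearProb a n x s := Finset.sum_nonneg fun w _ => ha.wordProb_nonneg w

theorem IsExcitingFunction.nearProb_mono (ha : IsExcitingFunction a) (n : ℕ) (x : ℝ) {s t : ℝ}
    (hst : s ≤ t) : nearProb a n x s ≤ nearProb a n x t :=
  Finset.sum_le_sum_of_subset_of_nonneg
    (fun _ hw => mem_nearWords.2 ⟨(mem_nearWords.1 hw).1, (mem_nearWords.1 hw).2.trans hst⟩)
    fun w _ _ => ha.wordProb_nonneg w

theorem IsExcitingFunction.nearProb_mul_le (ha : IsExcitingFunction a) (m n : ℕ) (x s t : ℝ) :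
    splitConst a * (nearProb a n x t * nearProb a m x s) ≤ nearProb a (m + n) x (s + t) := by
  rw [nearProb, nearProb, Finset.sum_mul_sum, ← Finset.sum_product', Finset.mul_sum]
  refine (Finset.sum_le_sum fun p _ => ha.splitConst_mul_le p.1 p.2).trans ?_
  have hinj : Set.InjOn (fun p : List Bool × List Bool => p.1 ++ p.2)
      (nearWords n x t ×ˢ nearWords m x s : Finset (List Bool × List Bool)) := by
    rintro ⟨y, z⟩ h ⟨y', z'⟩ h' e
    simp only [Finset.coe_product, Set.mem_prod, Finset.mem_coe, mem_nearWords] at h h'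
    obtain ⟨h1, h2⟩ := List.append_inj e (h.1.1.trans h'.1.1.symm)
    exact Prod.ext h1 h2
  rw [← Finset.sum_image (f := wordProb a) hinj]
  refine Finset.sum_le_sum_of_subset_of_nonneg ?_ fun w _ _ => ha.wordProb_nonneg w
  intro w hw
  obtain ⟨⟨y, z⟩, h, rfl⟩ := Finset.mem_image.1 hw
  simp only [Finset.mem_product, mem_nearWords] at h
  obtain ⟨⟨h1, h2⟩, h3, h4⟩ := h
  refine mem_nearWords.2 ⟨by simp [h1, h3, add_comm], ?_⟩
  rw [List.count_append]
  push_cast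
  rw [abs_le] at *
  constructor <;> linarith

/-- Concatenation of `k` blocks of length `m`. -/
theorem IsExcitingFunction.nearProb_pow_le (ha : IsExcitingFunction a) (m k : ℕ) (x s : ℝ) :
    (splitConst a * nearProb a m x s) ^ k ≤ nearProb a (m * k) x (k * s) := by
  induction k with
  | zero =>
    have : nearProb a 0 x 0 = 1 := by
      have : nearWords 0 x 0 = {[]} := by
        ext w
        simp only [mem_nearWords, List.length_eq_zero_iff, Finset.mem_singleton]
        constructor
        · exact fun h => h.1
        · rintro rfl
          simp
      simp [nearProb, this, wordProb]
    simp [this]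
  | succ k ih =>
    calc (splitConst a * nearProb a m x s) ^ (k + 1)
        = splitConst a * (nearProb a m x s * (splitConst a * nearProb a m x s) ^ k) := by ring
      _ ≤ splitConst a * (nearProb a m x s * nearProb a (m * k) x (k * s)) := by
          have := (splitConst_pos a).le
          have := ha.nearProb_nonneg m x s
          gcongr
      _ ≤ nearProb a (m * k + m) x (k * s + s) := ha.nearProb_mul_le _ _ _ _ _
      _ = _ := by
          push_cast
          rw [add_mul, one_mul, Nat.mul_succ]

theorem sum_words_wordProb (a : ℕ → ℝ) (n : ℕ) :
    ∑ w ∈ words n, wordProb a w = 1 := by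
  induction n with
  | zero =>
    have : words 0 = {[]} := by ext w; simp [List.length_eq_zero_iff]
    simp [this, wordProb]
  | succ n ih =>
    have : words (n + 1) = (words n ×ˢ Finset.univ).image
        fun p : List Bool × Bool => p.2 :: p.1 := by
      ext w
      cases w with
      | nil => simp
      | cons b w => simp
    rw [this, Finset.sum_image (by rintro ⟨y, b⟩ _ ⟨y', b'⟩ _ e; simp_all), Finset.sum_product,
      ← ih]
    refine Finset.sum_congr rfl fun w _ => ?_
    simp [wordProb, letterProb]
    ring

/-- The word with `⌊n x⌋` ones. -/
theorem IsExcitingFunction.minProb_pow_le_nearProb (ha : IsExcitingFunction a) (n : ℕ) {x s : ℝ}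
    (hx : x ∈ Set.Icc (0 : ℝ) 1) (hs : 1 ≤ s) : minProb a ^ n ≤ nearProb a n x s := by
  have hnx : 0 ≤ n * x := mul_nonneg n.cast_nonneg hx.1
  have hk : ⌊n * x⌋₊ ≤ n := by
    have : n * x ≤ n := mul_le_of_le_one_right n.cast_nonneg hx.2
    exact_mod_cast (Nat.floor_le hnx).trans this
  set k := ⌊n * x⌋₊ with hkd
  set w := List.replicate k true ++ List.replicate (n - k) false with hw
  have hlen : w.length = n := by simp [hw, hk]
  have hcount : w.count true = k := by simp [hw, List.count_append, List.count_replicate]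
  have hmem : w ∈ nearWords n x s := by
    refine mem_nearWords.2 ⟨hlen, ?_⟩
    rw [hcount]
    have h1 := Nat.floor_le hnx
    have h2 := Nat.lt_floor_add_one (n * x)
    rw [abs_le]
    constructor <;> linarith
  calc minProb a ^ n = minProb a ^ w.length := by rw [hlen]
    _ ≤ wordProb a w := ha.minProb_pow_le_wordProb w
    _ ≤ nearProb a n x s := Finset.single_le_sum (f := wordProb a)
        (fun w _ => ha.wordProb_nonneg w) hmem

theorem nearProb_eq_one (a : ℕ → ℝ) (n : ℕ) {x s : ℝ}
    (hx : x ∈ Set.Icc (0 : ℝ) 1) (hs : n ≤ s) : nearProb a n x s = 1 := by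
  rw [← sum_words_wordProb a n, nearProb]
  congr 1
  ext w
  rw [mem_nearWords, mem_words, and_iff_left_iff_imp]
  intro hl
  have h1 : (w.count true : ℝ) ≤ n := by exact_mod_cast hl ▸ List.count_le_length
  have h2 : 0 ≤ n * x := mul_nonneg n.cast_nonneg hx.1
  have h3 : n * x ≤ n := mul_le_of_le_one_right n.cast_nonneg hx.2
  have h4 : (0 : ℝ) ≤ w.count true := Nat.cast_nonneg _
  rw [abs_le]
  constructor <;> linarith

/-- Many blocks of length `m` followed by a remainder shorter than `m`. -/
theorem IsExcitingFunction.eventually_nearProb_ge (ha : IsExcitingFunction a) {x ε ε' : ℝ}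
    (hx : x ∈ Set.Icc (0 : ℝ) 1) (hε' : 0 ≤ ε') (hε : ε' < ε) {m : ℕ} (hm : 0 < m) :
    ∀ᶠ n : ℕ in atTop, splitConst a * (splitConst a * nearProb a m x (m * ε')) ^ (n / m) ≤
      nearProb a n x (n * ε) := by
  have ht : ∀ᶠ n : ℕ in atTop, (m : ℝ) ≤ n * (ε - ε') :=
    (tendsto_natCast_atTop_atTop.atTop_mul_const (sub_pos.2 hε)).eventually_ge_atTop _
  filter_upwards [ht] with n hn
  have h1 := ha.nearProb_mul_le (m * (n / m)) (n % m) x ((n / m : ℕ) * (m * ε')) (n % m : ℕ)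
  rw [nearProb_eq_one a (n % m) hx le_rfl, one_mul, Nat.div_add_mod] at h1
  have h2 : splitConst a * (splitConst a * nearProb a m x (m * ε')) ^ (n / m) ≤
      splitConst a * nearProb a (m * (n / m)) x ((n / m : ℕ) * (m * ε')) :=
    mul_le_mul_of_nonneg_left (ha.nearProb_pow_le _ _ _ _) (splitConst_pos a).le
  refine (h2.trans h1).trans (ha.nearProb_mono n x ?_)
  have h3 : ((n % m : ℕ) : ℝ) ≤ m := by exact_mod_cast (Nat.mod_lt n hm).le
  have h4 : ((n / m : ℕ) : ℝ) * m ≤ n := by exact_mod_cast Nat.div_mul_le_self n m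
  nlinarith

/-! ### The local rate -/

/-- The exponents `s ≥ 0` such that the density of ones is eventually within any `ε` of `x` with
probability at least `exp (-n s)`. -/
def rateSet (a : ℕ → ℝ) (x : ℝ) : Set ℝ :=
  {s | 0 ≤ s ∧ ∀ ε > 0, ∀ᶠ n : ℕ in atTop, Real.exp (-(n * s)) ≤ nearProb a n x (n * ε)}

/-- The exponential rate of decay of the probability that the density of ones is near `x`. -/
noncomputable def localRate (a : ℕ → ℝ) (x : ℝ) : ℝ := sInf (rateSet a x)

theorem IsExcitingFunction.rateSet_nonempty (ha : IsExcitingFunction a) {x : ℝ}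
    (hx : x ∈ Set.Icc (0 : ℝ) 1) : (rateSet a x).Nonempty := by
  have hc := ha.minProb_pos
  refine ⟨-Real.log (minProb a), ?_, fun ε hε => ?_⟩
  · have : minProb a ≤ 1 := (min_le_right _ _).trans (by linarith [ha.tail_nonneg 0])
    linarith [Real.log_nonpos hc.le this]
  · filter_upwards [(tendsto_natCast_atTop_atTop.atTop_mul_const hε).eventually_ge_atTop 1]
      with n hn
    refine le_trans (le_of_eq ?_) (ha.minProb_pow_le_nearProb n hx hn)
    rw [mul_neg, neg_neg, Real.exp_nat_mul, Real.exp_log hc]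

theorem localRate_nonneg (a : ℕ → ℝ) (x : ℝ) : 0 ≤ localRate a x :=
  Real.sInf_nonneg fun _ h => h.1

theorem IsExcitingFunction.exp_le_nearProb (ha : IsExcitingFunction a) {x : ℝ}
    (hx : x ∈ Set.Icc (0 : ℝ) 1) {ε δ : ℝ} (hε : 0 < ε) (hδ : 0 < δ) :
    ∀ᶠ n : ℕ in atTop, Real.exp (-(n * (localRate a x + δ))) ≤ nearProb a n x (n * ε) := by
  obtain ⟨s, hs, hlt⟩ := exists_lt_of_csInf_lt (ha.rateSet_nonempty hx)
    (show sInf (rateSet a x) < localRate a x + δ by rw [localRate]; linarith)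
  filter_upwards [hs.2 ε hε] with n hn
  refine le_trans ?_ hn
  gcongr

/-- If the probability of being near `x` exceeded the asserted bound for some large block length
`m`, concatenating such blocks would make it exceed `exp (-n s)` for all large `n`, although the
exponent `s` is below the rate. -/
theorem IsExcitingFunction.nearProb_le_exp (ha : IsExcitingFunction a) {x : ℝ}
    (hx : x ∈ Set.Icc (0 : ℝ) 1) {δ : ℝ} (hδ : 0 < δ) :
    ∃ ε > 0, ∀ᶠ n : ℕ in atTop,
      nearProb a n x (n * ε) ≤ Real.exp (-(n * (localRate a x - δ))) := by
  have hκ := splitConst_pos a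
  set r := localRate a x - δ with hr
  set s := r + δ / 2 with hs
  have hle1 : ∀ (n : ℕ) (t : ℝ), nearProb a n x t ≤ 1 := fun n t => by
    refine (ha.nearProb_mono n x (le_max_left t n)).trans ?_
    exact (nearProb_eq_one a n hx (le_max_right _ _)).le
  rcases lt_or_ge r 0 with hr0 | hr0
  · refine ⟨1, one_pos, Eventually.of_forall fun n => (hle1 n _).trans ?_⟩
    rw [Real.one_le_exp_iff]
    have : (0 : ℝ) ≤ n := n.cast_nonneg
    nlinarith
  have hns : s ∉ rateSet a x := fun hmem => by
    have : localRate a x ≤ s := csInf_le ⟨0, fun _ h => h.1⟩ hmem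
    linarith
  have hs0 : 0 ≤ s := by linarith
  have : ∃ ε > 0, ∃ᶠ n : ℕ in atTop, nearProb a n x (n * ε) < Real.exp (-(n * s)) := by
    by_contra! hcon
    refine hns ⟨hs0, fun ε hε => ?_⟩
    simpa [not_frequently] using hcon ε hε
  obtain ⟨ε, hε, hfreq⟩ := this
  refine ⟨ε / 2, by linarith, ?_⟩
  -- The block length is large enough for one factor `splitConst a` per block to be harmless.
  filter_upwards [eventually_mul_exp_le (splitConst a)⁻¹ (show (0 : ℝ) < δ / 4 by linarith),
    eventually_gt_atTop 0] with m hm hm0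
  by_contra! hbig
  refine hfreq ?_
  rw [mul_zero, Real.exp_zero, mul_one] at hm
  have hblock : Real.exp (-(m * (r + δ / 4))) ≤ splitConst a * nearProb a m x (m * (ε / 2)) := by
    have h1 : Real.exp (-(m * (δ / 4))) ≤ splitConst a := by
      rw [Real.exp_neg]
      exact inv_le_of_inv_le₀ hκ hm
    calc Real.exp (-(m * (r + δ / 4))) = Real.exp (-(m * (δ / 4))) * Real.exp (-(m * r)) := by
          rw [← Real.exp_add]; ring_nf
      _ ≤ _ := by gcongr
  filter_upwards [ha.eventually_nearProb_ge hx (by linarith) (half_lt_self hε) hm0,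
    eventually_mul_exp_le (splitConst a)⁻¹ (show -s < -(r + δ / 4) by linarith)] with n hn hn'
  rw [not_lt]
  refine le_trans ?_ hn
  rw [inv_mul_le_iff₀ hκ] at hn'
  rw [← mul_neg]
  refine hn'.trans (mul_le_mul_of_nonneg_left ?_ hκ.le)
  calc Real.exp (n * -(r + δ / 4)) ≤ Real.exp ((n / m : ℕ) * -(m * (r + δ / 4))) := by
        have h4 : ((n / m : ℕ) : ℝ) * m ≤ n := by exact_mod_cast Nat.div_mul_le_self n m
        rw [Real.exp_le_exp]
        nlinarith
    _ = Real.exp (-(m * (r + δ / 4))) ^ (n / m) := Real.exp_nat_mul _ _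
    _ ≤ _ := pow_le_pow_left₀ (Real.exp_pos _).le hblock _

end Near

end Hawkes

namespace Hawkes

/-! ### The law of an arrival process -/

section Law

variable {Ω : Type*} {ξ : ℕ → Ω → ℝ}

open Classical in
/-- The word `ξ_n, …, ξ_1` of arrivals up to time `n`. -/
noncomputable def past (ξ : ℕ → Ω → ℝ) : ℕ → Ω → List Bool
  | 0, _ => []
  | n + 1, ω => decide (ξ (n + 1) ω = 1) :: past ξ n ω

theorem length_past (ξ : ℕ → Ω → ℝ) (n : ℕ) (ω : Ω) : (past ξ n ω).length = n := by
  induction n with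
  | zero => rfl
  | succ n ih => simp [past, ih]

theorem measurable_history {n i : ℕ} (h1 : 1 ≤ i) (hn : i ≤ n) : Measurable[history ξ n] (ξ i) :=
  Measurable.of_comap_le <|
    le_iSup₂_of_le (f := fun i (_ : i ∈ Finset.Icc 1 n) => MeasurableSpace.comap (ξ i) _) i
      (Finset.mem_Icc.2 ⟨h1, hn⟩) le_rfl

theorem measurableSet_past_eq {n m : ℕ} (hnm : n ≤ m) (w : List Bool) :
    MeasurableSet[history ξ m] {ω | past ξ n ω = w} := by
  induction n generalizing w with
  | zero => simp [past]
  | succ n ih =>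
    have hs : MeasurableSet[history ξ m] {ω | ξ (n + 1) ω = 1} :=
      measurable_history (by omega) hnm (measurableSet_singleton 1)
    cases w with
    | nil => simp [past]
    | cons b w =>
      have : {ω | past ξ (n + 1) ω = b :: w} =
          (if b then {ω | ξ (n + 1) ω = 1} else {ω | ξ (n + 1) ω = 1}ᶜ) ∩
            {ω | past ξ n ω = w} := by
        ext ω
        cases b <;> simp [past]
      rw [this]
      refine MeasurableSet.inter ?_ (ih (by omega) w)
      split_ifs
      · exact hs
      · exact hs.compl

variable [MeasurableSpace Ω] {P : Measure Ω} {a : ℕ → ℝ}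

theorem IsArrivalProcess.history_le (h : IsArrivalProcess P a ξ) (n : ℕ) :
    history ξ n ≤ ‹MeasurableSpace Ω› :=
  iSup₂_le fun i hi => (h.measurable i (Finset.mem_Icc.1 hi).1).comap_le

theorem IsArrivalProcess.hawkes_eq_count (h : IsArrivalProcess P a ξ) (n : ℕ) (ω : Ω) :
    hawkes ξ n ω = (past ξ n ω).count true := by
  induction n with
  | zero => simp [hawkes, past]
  | succ n ih =>
    rw [hawkes, Finset.sum_Icc_succ_top (by omega), ← hawkes, ih, past]
    rcases h.zero_or_one (n + 1) (by omega) ω with e | e <;> simp [e]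

theorem IsArrivalProcess.sum_eq_excite (h : IsArrivalProcess P a ξ) (n j : ℕ) (ω : Ω) :
    ∑ i ∈ Finset.Icc 1 n, a (n + j - i) * ξ i ω = excite a j (past ξ n ω) := by
  induction n generalizing j with
  | zero => simp [past, excite]
  | succ n ih =>
    rw [Finset.sum_Icc_succ_top (by omega), past, excite, ← ih (j + 1), add_comm]
    congr 1
    · rcases h.zero_or_one (n + 1) (by omega) ω with e | e <;> simp [e]
    · exact Finset.sum_congr rfl fun i _ => by rw [add_right_comm, add_assoc]

theorem IsArrivalProcess.intensity_eq (h : IsArrivalProcess P a ξ) (n : ℕ) (ω : Ω) :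
    intensity a ξ (n + 1) ω = a 0 + excite a 1 (past ξ n ω) := by
  rw [intensity, ← h.sum_eq_excite n 1 ω, Nat.add_sub_cancel]

theorem IsArrivalProcess.measurableSet_letter (h : IsArrivalProcess P a ξ) (n : ℕ) (b : Bool) :
    MeasurableSet {ω | ξ (n + 1) ω = if b then 1 else 0} :=
  h.measurable (n + 1) (by omega) (measurableSet_singleton _)

/-- Integrating the conditional probability of a letter over a given past. -/
theorem IsArrivalProcess.real_letter_inter_past [IsProbabilityMeasure P] (ha0 : 0 ≤ a 0)
    (ha1 : a 0 ≤ 1) (h : IsArrivalProcess P a ξ) (n : ℕ) (b : Bool) (w : List Bool) :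
    P.real ({ω | ξ (n + 1) ω = if b then 1 else 0} ∩ {ω | past ξ n ω = w}) =
      letterProb a b w * P.real {ω | past ξ n ω = w} := by
  rcases n.eq_zero_or_pos with rfl | hn
  · cases w with
    | nil =>
      cases b
      · simp [past, letterProb, excite, Measure.real, h.prob_first_zero, ha1]
      · simp [past, letterProb, excite, Measure.real, h.prob_first_one, ha0]
    | cons b w => simp [past]
  have hA := h.measurableSet_letter n b
  have hB := measurableSet_past_eq (ξ := ξ) le_rfl w (n := n)
  have hB' := h.history_le n _ hB
  have hcond : P⟦{ω | ξ (n + 1) ω = if b then 1 else 0} | history ξ n⟧ =ᵐ[P]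
      fun ω => letterProb a b (past ξ n ω) := by
    cases b
    · have := h.condProb_zero (n + 1) (by omega)
      simpa [h.intensity_eq, letterProb] using this
    · have := h.condProb_one (n + 1) (by omega)
      simpa [h.intensity_eq, letterProb] using this
  have hint := setIntegral_condExp (μ := P) (h.history_le n)
    ((integrable_const (1 : ℝ)).indicator hA) hB
  rw [setIntegral_indicator hA, setIntegral_const, smul_eq_mul, mul_one] at hint
  rw [Set.inter_comm, ← hint, setIntegral_congr_ae (g := fun _ => letterProb a b w) hB',
    setIntegral_const, smul_eq_mul, mul_comm]
  filter_upwards [hcond] with ω hω hωB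
  rw [hω, show past ξ n ω = w from hωB]

theorem IsArrivalProcess.real_past_eq [IsProbabilityMeasure P] (ha0 : 0 ≤ a 0)
    (ha1 : a 0 ≤ 1) (h : IsArrivalProcess P a ξ) (n : ℕ) (w : List Bool) (hw : w.length = n) :
    P.real {ω | past ξ n ω = w} = wordProb a w := by
  induction w generalizing n with
  | nil =>
    subst hw
    simp [past, wordProb]
  | cons b w ih =>
    subst hw
    rw [wordProb, ← ih w.length rfl, ← h.real_letter_inter_past ha0 ha1, List.length_cons]
    congr 1
    ext ω
    rcases h.zero_or_one (w.length + 1) (by omega) ω with e | e <;> cases b <;> simp [past, e]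

theorem IsArrivalProcess.real_abs_hawkes_sub_le [IsProbabilityMeasure P] (ha0 : 0 ≤ a 0)
    (ha1 : a 0 ≤ 1) (h : IsArrivalProcess P a ξ) (n : ℕ) (x s : ℝ) :
    P.real {ω | |hawkes ξ n ω - n * x| ≤ s} = nearProb a n x s := by
  have : {ω | |hawkes ξ n ω - n * x| ≤ s} = ⋃ w ∈ nearWords n x s, {ω | past ξ n ω = w} := by
    ext ω
    simp [mem_nearWords, h.hawkes_eq_count, length_past]
  rw [this, measureReal_biUnion_finset, nearProb]
  · exact Finset.sum_congr rfl fun w hw => h.real_past_eq ha0 ha1 n w (mem_nearWords.1 hw).1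
  · intro w _ w' _ hne
    refine Set.disjoint_left.2 fun ω hω hω' => hne ?_
    exact (show past ξ n ω = w from hω).symm.trans hω'
  · exact fun w _ => h.history_le n _ (measurableSet_past_eq le_rfl w)

theorem IsArrivalProcess.measurable_average (h : IsArrivalProcess P a ξ) (n : ℕ) :
    Measurable (average h n) := by
  refine Measurable.subtype_mk (Measurable.div_const ?_ _)
  exact Finset.measurable_fun_sum _ fun i hi => h.measurable i (Finset.mem_Icc.1 hi).1

theorem IsArrivalProcess.real_average_closedBall [IsProbabilityMeasure P]
    (ha : IsExcitingFunction a) (h : IsArrivalProcess P a ξ) {n : ℕ} (hn : 0 < n)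
    (x : Set.Icc (0 : ℝ) 1) (ε : ℝ) :
    P.real (average h n ⁻¹' Metric.closedBall x ε) = nearProb a n x (n * ε) := by
  have ha1 : a 0 ≤ 1 := by
    have h1 := ha.tail_zero_lt_one
    have h2 := ha.tail_eq 0
    have h3 := ha.tail_nonneg (0 + 1)
    linarith
  rw [← h.real_abs_hawkes_sub_le (ha.pos 0).le ha1]
  congr 1
  ext ω
  have hn' : (0 : ℝ) < n := Nat.cast_pos.2 hn
  have : hawkes ξ n ω - n * x = n * (hawkes ξ n ω / n - x) := by field_simp
  simp only [Set.mem_preimage, Metric.mem_closedBall, Subtype.dist_eq, average, Real.dist_eq,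
    Set.mem_ofPred_eq]
  rw [this, abs_mul, abs_of_pos hn', mul_le_mul_iff_right₀ hn']

theorem IsArrivalProcess.hasLocalRate [IsProbabilityMeasure P] (ha : IsExcitingFunction a)
    (h : IsArrivalProcess P a ξ) :
    HasLocalRate P (average h) fun x : Set.Icc (0 : ℝ) 1 => localRate a x where
  nonneg x := localRate_nonneg a x
  lower x ε hε δ hδ := by
    filter_upwards [ha.exp_le_nearProb x.2 hε hδ, eventually_gt_atTop 0] with n hn hn0
    rwa [h.real_average_closedBall ha hn0]
  upper x δ hδ := by
    obtain ⟨ε, hε, H⟩ := ha.nearProb_le_exp x.2 hδ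
    refine ⟨ε, hε, ?_⟩
    filter_upwards [H, eventually_gt_atTop 0] with n hn hn0
    rwa [h.real_average_closedBall ha hn0]

end Law

end Hawkes

theorem theorem4p1 {Ω : Type*} [MeasurableSpace Ω] (P : Measure Ω) [IsProbabilityMeasure P]
    (a : ℕ → ℝ) (ha : Hawkes.IsExcitingFunction a)
    (ξ : ℕ → Ω → ℝ) (hξ : Hawkes.IsArrivalProcess P a ξ) :
    ∃ (Γ : (Set.Icc (0 : ℝ) 1 →ᵇ ℝ) → ℝ) (R : Set.Icc (0 : ℝ) 1 → ℝ≥0∞),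
      (∀ g : Set.Icc (0 : ℝ) 1 →ᵇ ℝ,
        Tendsto
          (fun n : ℕ =>
            (1 / (n : ℝ)) * Real.log (∫ ω, Real.exp (n * g (Hawkes.average hξ n ω)) ∂P))
          atTop (𝓝 (Γ g))) ∧
      (∀ x, (R x : EReal) = ⨆ g : Set.Icc (0 : ℝ) 1 →ᵇ ℝ, ((g x - Γ g : ℝ) : EReal)) ∧
      Hawkes.IsGoodRateFunction R ∧
      Hawkes.SatisfiesLDP P (Hawkes.average hξ) R := by 
  have h := hξ.hasLocalRate ha
  have hY := hξ.measurable_average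
  exact ⟨Hawkes.HasLocalRate.gamma _, _, h.tendsto_gamma hY, h.coe_ofReal_eq_iSup,
    h.isGoodRateFunction, h.satisfiesLDP hY⟩
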